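/- Throughout, all $C^*$-algebras may be non-unital. For $C^*$-algebras $A,B$, a $C^*$-correspondence ${}_AX_B$ is a right Hilbert $B$-module $X$ together with a $*$-homomorphism $\phi_X$ from $A$ to the adjointable operators on $X$ (no non-degeneracy, injectivity or fullness is assumed). Write $X\approx Y$ if there is a unitary $u:X\to Y$ with $u(\phi_X(a)\xi b)=\phi_Y(a)(u\xi)b$ for all $a\in A$, $b\in B$, $\xi\in X$. For ${}_AX_B$ and ${}_BY_C$, let $X\otimes_B Y$ be the interior tensor product, i.e. the correspondence from $A$ to $C$ obtained by completing the algebraic tensor product for $\langle \xi_1\otimes\eta_1,\xi_2\otimes\eta_2\rangle=\langle\eta_1,\phi_Y(\langle\xi_1,\xi_2\rangle)\eta_2\rangle$, with $\phi(a)(\xi\otimes\eta)=(\phi_X(a)\xi)\otimes\eta$. An $A$-$B$-imprimitivity bimodule is a correspondence ${}_AM_B$ with a left $A$-valued inner product making it a left Hilbert $A$-module, such that ${}_A\langle\xi,\eta\rangle\,\zeta=\xi\,\langle\eta,\zeta\rangle_B$, and such that $M$ is full on both sides (the closed linear spans of the inner products are $A$ and $B$). Let ${}_AE_A$ and ${}_BF_B$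 be $C^*$-correspondences. - $E$ and $F$ are strong Morita equivalent if $E\otimes_A M\approx M\otimes_B F$ for some $A$-$B$-imprimitivity bimodule $M$. - They are elementary strong shift equivalent if there are correspondences ${}_AR_B$ and ${}_BS_A$ with $E\approx R\otimes_B S$ and $F\approx S\otimes_A R$. - They are strong shift equivalent if there are $n\ge 1$ and $C^*$-correspondences $T_0=E,T_1,\dots,T_n=F$, each over some $C^*$-algebra, such that $T_i$ and $T_{i+1}$ are elementary strong shift equivalent for $0\le i<n$. - They are shift equivalent if there are correspondences ${}_AR_B$ and ${}_BS_A$ and an integer $m\ge 1$ with $E^{\otimes m}\approx R\otimes_B S$, $F^{\otimes m}\approx S\otimes_A R$, $S\otimes_A E\approx F\otimes_B S$ and $E\otimes_A R\approx R\otimes_B F$. **Theorem.** For all $C^*$-correspondences ${}_AE_A$ and ${}_BF_B$: if $E$ and $F$ are strong Morita equivalent, then they are elementary strong shift equivalent; if they are elementary strong shift equivalent, then they are strong shift equivalent; and if they are strong shift equivalent, then they are shift equivalent. -/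

import Mathlib

universe u

namespace CStarCorr

open scoped TensorProduct ComplexConjugate

/-- Positivity of an element of a C*-algebra. -/
def IsPos {A : Type u} [NonUnitalCStarAlgebra A] (a : A) : Prop :=
  ∃ b : A, a = star b * b

section Positivity

variable {A : Type u} [NonUnitalCStarAlgebra A]

theorem isPos_iff_nonneg [PartialOrder A] [StarOrderedRing A] {a : A} : IsPos a ↔ 0 ≤ a :=
  CStarAlgebra.nonneg_iff_eq_star_mul_self.symm

theorem IsPos.sum {ι : Type*} {s : Finset ι} {f : ι → A} (h : ∀ i ∈ s, IsPos (f i)) :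
    IsPos (∑ i ∈ s, f i) := by
  let _ := CStarAlgebra.spectralOrder A
  have _ := CStarAlgebra.spectralOrderedRing A
  exact isPos_iff_nonneg.2 (Finset.sum_nonneg fun i hi => isPos_iff_nonneg.1 (h i hi))

theorem isClosed_isPos : IsClosed {a : A | IsPos a} := by
  let _ := CStarAlgebra.spectralOrder A
  have _ := CStarAlgebra.spectralOrderedRing A
  simpa only [isPos_iff_nonneg] using CStarAlgebra.isClosed_nonneg (A := A)

theorem IsPos.norm_le {a b : A} (ha : IsPos a) (hab : IsPos (b - a)) : ‖a‖ ≤ ‖b‖ := by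
  let _ := CStarAlgebra.spectralOrder A
  have _ := CStarAlgebra.spectralOrderedRing A
  rw [isPos_iff_nonneg] at ha hab
  exact CStarAlgebra.norm_le_norm_of_nonneg_of_le ha (sub_nonneg.1 hab)

theorem IsPos.conj_le {a : A} (ha : IsSelfAdjoint a) (c : A) :
    IsPos (‖a‖ • (star c * c) - star c * a * c) := by
  let _ := CStarAlgebra.spectralOrder A
  have _ := CStarAlgebra.spectralOrderedRing A
  exact isPos_iff_nonneg.2 (sub_nonneg.2 (CStarAlgebra.star_left_conjugate_le_norm_smul ha))

theorem IsPos.add {a b : A} (ha : IsPos a) (hb : IsPos b) : IsPos (a + b) := by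
  let _ := CStarAlgebra.spectralOrder A
  have _ := CStarAlgebra.spectralOrderedRing A
  rw [isPos_iff_nonneg] at *
  exact add_nonneg ha hb

theorem IsPos.smul {a : A} (ha : IsPos a) {r : ℝ} (hr : 0 ≤ r) : IsPos (r • a) := by
  obtain ⟨b, rfl⟩ := ha
  refine ⟨Real.sqrt r • b, ?_⟩
  rw [star_smul, smul_mul_smul_comm]
  simp [Real.mul_self_sqrt hr]

/-- The negative part of a selfadjoint element, with the properties used below. -/
theorem exists_negPart {h : A} (hh : IsSelfAdjoint h) :
    ∃ Q S : A, star Q = Q ∧ Q = star S * S ∧ Q * h * Q = -(Q * Q * Q) ∧ (Q = 0 → IsPos h) := by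
  let _ := CStarAlgebra.spectralOrder A
  have _ := CStarAlgebra.spectralOrderedRing A
  have hQ0 : 0 ≤ h⁻ := CFC.negPart_nonneg h
  obtain ⟨S, hS⟩ := CStarAlgebra.nonneg_iff_eq_star_mul_self.1 hQ0
  have h2 : h⁺ * h⁻ = 0 := CFC.posPart_mul_negPart h
  have h3 : h⁺ - h⁻ = h := CFC.posPart_sub_negPart h hh
  refine ⟨h⁻, S, (IsSelfAdjoint.of_nonneg hQ0).star_eq, hS, ?_, fun h0 => ?_⟩
  · calc h⁻ * h * h⁻ = h⁻ * (h * h⁻) := mul_assoc _ _ _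
      _ = h⁻ * ((h⁺ - h⁻) * h⁻) := by rw [h3]
      _ = -(h⁻ * h⁻ * h⁻) := by rw [sub_mul, h2, zero_sub, mul_neg, mul_assoc]
  · rw [h0, sub_zero] at h3
    rw [isPos_iff_nonneg, ← h3]
    exact CFC.posPart_nonneg h

/-- A matrix over a C*-algebra whose quadratic form is positive
is of the form `T* T`. -/
theorem exists_matrix_factor {ι : Type*} [Fintype ι] (M : ι → ι → A)
    (hM : ∀ i j, star (M i j) = M j i)
    (hpos : ∀ v : ι → A, IsPos (∑ i, ∑ j, star (v i) * M i j * v j)) :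
    ∃ T : ι → ι → A, ∀ i j, M i j = ∑ k, star (T k i) * T k j := by
  let _ := CStarAlgebra.spectralOrder A
  have _ := CStarAlgebra.spectralOrderedRing A
  let N : CStarMatrix ι ι A := CStarMatrix.ofMatrix (Matrix.of M)
  have hN : IsSelfAdjoint N := by
    ext i j
    simp only [CStarMatrix.star_apply]
    exact hM j i
  obtain ⟨Q, S, hQs, hS, hQN, hNpos⟩ := exists_negPart hN
  have h1 : Q * N * Q = -(star (S * Q) * (S * Q)) := by
    rw [hQN, star_mul, hQs]
    nth_rewrite 2 [hS]
    simp only [mul_assoc]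
  have h4 : S * Q = 0 := by
    ext i j
    have h5 := hpos (fun i => Q i j)
    have h6 : (∑ i, ∑ k, star (Q i j) * M i k * Q k j) = (Q * N * Q) j j := by
      simp only [CStarMatrix.mul_apply, Finset.sum_mul]
      rw [Finset.sum_comm]
      refine Finset.sum_congr rfl fun k _ => Finset.sum_congr rfl fun l _ => ?_
      have : star (Q l j) = Q j l := by
        conv_rhs => rw [← hQs]
        rfl
      rw [this]; rfl
    rw [h6, h1, isPos_iff_nonneg] at h5
    have h7 : (star (S * Q) * (S * Q)) j j = ∑ k, star ((S * Q) k j) * (S * Q) k j := by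
      rw [CStarMatrix.mul_apply]
      rfl
    have h8 : (∑ k, star ((S * Q) k j) * (S * Q) k j) = 0 := by
      refine le_antisymm ?_ (Finset.sum_nonneg fun k _ => star_mul_self_nonneg _)
      rw [← h7]
      exact neg_nonneg.1 h5
    have h9 := (Finset.sum_eq_zero_iff_of_nonneg
      (fun k _ => star_mul_self_nonneg ((S * Q) k j))).1 h8 i (Finset.mem_univ _)
    exact (CStarRing.star_mul_self_eq_zero_iff _).1 h9
  have h10 : star Q * Q = 0 := by
    rw [hQs]
    nth_rewrite 1 [hS]
    rw [mul_assoc, h4, mul_zero]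
  obtain ⟨T, hT⟩ := hNpos ((CStarRing.star_mul_self_eq_zero_iff _).1 h10)
  refine ⟨fun i j => T i j, fun i j => ?_⟩
  have : M i j = N i j := rfl
  rw [this, hT, CStarMatrix.mul_apply]
  rfl

/-- In a C*-algebra, possibly without unit, `‖a‖² - a* a = (‖a‖ + b)²` for some selfadjoint `b`. -/
theorem exists_defect_sqrt (a : A) :
    ∃ b : A, IsSelfAdjoint b ∧ (2 * ‖a‖) • b + b * b = -(star a * a) := by
  set h := star a * a with hh
  have hs : IsSelfAdjoint h := IsSelfAdjoint.star_mul_self a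
  let f : ℝ → ℝ := fun t => Real.sqrt (‖a‖ ^ 2 - t) - ‖a‖
  have f0 : f 0 = 0 := by simp [f]
  have fc : Continuous f := by fun_prop
  refine ⟨cfcₙ f h, cfcₙ_predicate f h, ?_⟩
  rw [← cfcₙ_smul (2 * ‖a‖) f h, ← cfcₙ_mul f f h, ← cfcₙ_add _ _ h, ← cfcₙ_neg_id (R := ℝ) h]
  refine cfcₙ_congr fun t ht => ?_
  have ht' : t ≤ ‖a‖ ^ 2 := by
    have h1 : ‖t‖ ≤ ‖h‖ := NonUnitalIsometricContinuousFunctionalCalculus.norm_quasispectrum_le h ht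
    rw [hh, CStarRing.norm_star_mul_self, ← pow_two] at h1
    exact (le_abs_self t).trans h1
  have := Real.mul_self_sqrt (sub_nonneg.2 ht')
  simp only [f, smul_eq_mul]
  linear_combination this

end Positivity
/-- A C*-correspondence from `A` to `B`: a right Hilbert `B`-module (complete in the norm
`‖ξ‖ = ‖⟪ξ, ξ⟫‖ ^ (1 / 2)`) with a `*`-homomorphism from `A` to its adjointable operators.
The right action is written `X.rsmul b ξ` for `ξ · b`, the left one `X.lsmul a ξ` for `φ(a) ξ`.
The inner product is linear in the second variable. The left action is only required to be a
`*`-homomorphism; it may be degenerate or zero. -/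
structure Correspondence (A B : Type u) [NonUnitalCStarAlgebra A] [NonUnitalCStarAlgebra B] where
  carrier : Type u
  [normedAddCommGroup : NormedAddCommGroup carrier]
  [normedSpace : NormedSpace ℂ carrier]
  [completeSpace : CompleteSpace carrier]
  rsmul : B →ₗ[ℂ] carrier →ₗ[ℂ] carrier
  rsmul_mul : ∀ b c ξ, rsmul (b * c) ξ = rsmul c (rsmul b ξ)
  inner : carrier →ₗ⋆[ℂ] carrier →ₗ[ℂ] B
  inner_rsmul : ∀ ξ η b, inner ξ (rsmul b η) = inner ξ η * b
  star_inner : ∀ ξ η, star (inner ξ η) = inner η ξ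
  inner_self_pos : ∀ ξ, IsPos (inner ξ ξ)
  norm_sq : ∀ ξ, ‖ξ‖ ^ 2 = ‖inner ξ ξ‖
  lsmul : A →ₗ[ℂ] carrier →ₗ[ℂ] carrier
  lsmul_mul : ∀ a b ξ, lsmul (a * b) ξ = lsmul a (lsmul b ξ)
  inner_lsmul : ∀ a ξ η, inner (lsmul a ξ) η = inner ξ (lsmul (star a) η)

attribute [instance] Correspondence.normedAddCommGroup Correspondence.normedSpace
  Correspondence.completeSpace

/-- A correspondence whose inner product may be degenerate and which need not be complete. -/
structure PreCorrespondence (A B : Type u) [NonUnitalCStarAlgebra A]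
    [NonUnitalCStarAlgebra B] where
  carrier : Type u
  [addCommGroup : AddCommGroup carrier]
  [module : Module ℂ carrier]
  rsmul : B →ₗ[ℂ] carrier →ₗ[ℂ] carrier
  rsmul_mul : ∀ b c ξ, rsmul (b * c) ξ = rsmul c (rsmul b ξ)
  inner : carrier →ₗ⋆[ℂ] carrier →ₗ[ℂ] B
  inner_rsmul : ∀ ξ η b, inner ξ (rsmul b η) = inner ξ η * b
  star_inner : ∀ ξ η, star (inner ξ η) = inner η ξ
  inner_self_pos : ∀ ξ, IsPos (inner ξ ξ)
  lsmul : A →ₗ[ℂ] carrier →ₗ[ℂ] carrier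
  lsmul_mul : ∀ a b ξ, lsmul (a * b) ξ = lsmul a (lsmul b ξ)
  inner_lsmul : ∀ a ξ η, inner (lsmul a ξ) η = inner ξ (lsmul (star a) η)

attribute [instance] PreCorrespondence.addCommGroup PreCorrespondence.module

namespace PreCorrespondence

variable {A B : Type u} [NonUnitalCStarAlgebra A] [NonUnitalCStarAlgebra B]
  (P : PreCorrespondence.{u} A B)

theorem inner_rsmul_left (ξ η : P.carrier) (b : B) :
    P.inner (P.rsmul b ξ) η = star b * P.inner ξ η := by
  rw [← P.star_inner, P.inner_rsmul, star_mul, P.star_inner]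

theorem norm_inner_sq_le (ξ η : P.carrier) :
    ‖P.inner ξ η‖ ^ 2 ≤ ‖P.inner ξ ξ‖ * ‖P.inner η η‖ := by
  set c := P.inner ξ η with hc
  have key : ∀ s : ℝ, ‖P.inner ξ ξ‖ < s → ‖c‖ ^ 2 ≤ s * ‖P.inner η η‖ := by
    intro s hs
    have hs0 : 0 < s := (norm_nonneg _).trans_lt hs
    have h1 := P.inner_self_pos (P.rsmul c ξ - (s : ℂ) • η)
    have hcc : IsPos (star c * c) := ⟨c, rfl⟩
    have h2 := IsPos.conj_le (P.star_inner ξ ξ) c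
    have h3 : IsPos ((s - ‖P.inner ξ ξ‖) • (star c * c)) := hcc.smul (sub_nonneg.2 hs.le)
    have h4 : IsPos ((s ^ 2 : ℝ) • P.inner η η - s • (star c * c)) := by
      convert (h1.add h2).add h3 using 1
      have h5 : P.inner η ξ = star c := (P.star_inner _ _).symm
      simp only [map_sub, LinearMap.sub_apply, map_smulₛₗ, LinearMap.smul_apply, P.inner_rsmul,
        P.inner_rsmul_left, h5, ← hc, Complex.conj_ofReal, RingHom.id_apply, mul_assoc]
      simp only [Complex.coe_smul]
      module
    have h6 : IsPos (s • (star c * c)) := hcc.smul hs0.le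
    have h7 := h6.norm_le h4
    rw [norm_smul, norm_smul, CStarRing.norm_star_mul_self, Real.norm_of_nonneg hs0.le,
      Real.norm_of_nonneg (by positivity)] at h7
    nlinarith [norm_nonneg c]
  refine le_of_forall_pos_le_add fun ε hε => ?_
  have h := key (‖P.inner ξ ξ‖ + ε / (‖P.inner η η‖ + 1)) (by
    have : 0 < ε / (‖P.inner η η‖ + 1) := by positivity
    linarith)
  refine h.trans ?_
  rw [add_mul]
  gcongr
  rw [div_mul_eq_mul_div, div_le_iff₀ (by positivity)]
  nlinarith

/-- The seminorm of a semi-inner product. -/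
noncomputable instance instNorm : Norm P.carrier := ⟨fun ξ => Real.sqrt ‖P.inner ξ ξ‖⟩

theorem norm_def (ξ : P.carrier) : ‖ξ‖ = Real.sqrt ‖P.inner ξ ξ‖ := rfl

theorem norm_sq (ξ : P.carrier) : ‖ξ‖ ^ 2 = ‖P.inner ξ ξ‖ := Real.sq_sqrt (norm_nonneg _)

theorem pre_norm_nonneg (ξ : P.carrier) : 0 ≤ ‖ξ‖ := Real.sqrt_nonneg _

theorem norm_inner_le (ξ η : P.carrier) : ‖P.inner ξ η‖ ≤ ‖ξ‖ * ‖η‖ := by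
  refine (le_abs_self _).trans (abs_le_of_sq_le_sq ?_ (mul_nonneg (P.pre_norm_nonneg _) (P.pre_norm_nonneg _)))
  rw [mul_pow, P.norm_sq, P.norm_sq]
  exact P.norm_inner_sq_le ξ η

theorem core : SeminormedSpace.Core ℂ P.carrier where
  norm_nonneg := P.pre_norm_nonneg
  norm_smul c ξ := by
    rw [P.norm_def, P.norm_def, map_smul, map_smulₛₗ, LinearMap.smul_apply, norm_smul, norm_smul,
      ← mul_assoc, RCLike.norm_conj, ← pow_two, Real.sqrt_mul (by positivity),
      Real.sqrt_sq (norm_nonneg _)]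
  norm_triangle ξ η := by
    refine (le_abs_self _).trans (abs_le_of_sq_le_sq ?_ (add_nonneg (P.pre_norm_nonneg _) (P.pre_norm_nonneg _)))
    have h1 := P.norm_inner_le ξ η
    have h2 := P.norm_inner_le η ξ
    have h3 : P.inner (ξ + η) (ξ + η)
        = P.inner ξ ξ + P.inner ξ η + P.inner η ξ + P.inner η η := by
      simp only [map_add, LinearMap.add_apply]; abel
    rw [P.norm_sq, h3]
    have h4 := norm_add₄_le (a := P.inner ξ ξ) (b := P.inner ξ η) (c := P.inner η ξ)
      (d := P.inner η η)
    rw [← P.norm_sq, ← P.norm_sq] at h4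
    nlinarith

noncomputable instance instSeminormedAddCommGroup : SeminormedAddCommGroup P.carrier :=
  SeminormedAddCommGroup.ofCore P.core

noncomputable instance instNormedSpace : NormedSpace ℂ P.carrier :=
  { norm_smul_le := fun c ξ => (P.core.norm_smul c ξ).le }

theorem norm_rsmul_le (b : B) (ξ : P.carrier) : ‖P.rsmul b ξ‖ ≤ ‖b‖ * ‖ξ‖ := by
  refine (le_abs_self _).trans (abs_le_of_sq_le_sq ?_ (mul_nonneg (norm_nonneg _) (P.pre_norm_nonneg _)))
  rw [P.norm_sq, P.inner_rsmul, P.inner_rsmul_left, mul_pow, P.norm_sq]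
  calc _ ≤ ‖star b‖ * ‖P.inner ξ ξ‖ * ‖b‖ := norm_mul₃_le
    _ = _ := by rw [norm_star]; ring

theorem norm_lsmul_le (a : A) (ξ : P.carrier) : ‖P.lsmul a ξ‖ ≤ ‖a‖ * ‖ξ‖ := by
  refine (le_abs_self _).trans (abs_le_of_sq_le_sq ?_ (mul_nonneg (norm_nonneg _) (P.pre_norm_nonneg _)))
  rw [P.norm_sq, mul_pow, P.norm_sq]
  obtain ⟨b, hb, hab⟩ := exists_defect_sqrt a
  have h1 := P.inner_self_pos ((‖a‖ : ℂ) • ξ + P.lsmul b ξ)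
  have h2 : IsPos ((‖a‖ ^ 2) • P.inner ξ ξ - P.inner (P.lsmul a ξ) (P.lsmul a ξ)) := by
    convert h1 using 1
    have h3 : P.inner (P.lsmul a ξ) (P.lsmul a ξ)
        = - P.inner ξ (P.lsmul ((2 * ‖a‖) • b + b * b) ξ) := by
      rw [hab, P.inner_lsmul, ← P.lsmul_mul]; simp
    have h4 : P.lsmul ((2 * ‖a‖) • b + b * b) ξ
        = ((2 * ‖a‖ : ℝ) : ℂ) • P.lsmul b ξ + P.lsmul b (P.lsmul b ξ) := by
      rw [← Complex.coe_smul, map_add, map_smul, LinearMap.add_apply, LinearMap.smul_apply,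
        P.lsmul_mul]
    rw [h3, h4]
    simp only [map_add, LinearMap.add_apply, map_smulₛₗ, LinearMap.smul_apply, P.inner_lsmul,
      hb.star_eq, Complex.conj_ofReal, RingHom.id_apply]
    simp only [Complex.coe_smul]
    module
  have h5 := (P.inner_self_pos (P.lsmul a ξ)).norm_le h2
  rwa [norm_smul, Real.norm_of_nonneg (by positivity)] at h5

/-- The underlying Banach space of the completion: the Hausdorff completion for the seminorm. -/
abbrev Compl : Type u := UniformSpace.Completion P.carrier

/-- The canonical map to the completion. -/
noncomputable def toCompl : P.carrier →ₗ[ℂ] P.Compl :=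
  (UniformSpace.Completion.toComplₗᵢ (𝕜 := ℂ) (E := P.carrier)).toLinearMap

theorem norm_toCompl (ξ : P.carrier) : ‖P.toCompl ξ‖ = ‖ξ‖ :=
  UniformSpace.Completion.norm_coe ξ

theorem denseRange_toCompl : DenseRange P.toCompl := UniformSpace.Completion.denseRange_coe

/-- Extension of a bounded operator to the completion. -/
noncomputable def extendOp (T : P.carrier →ₗ[ℂ] P.carrier) : P.Compl →L[ℂ] P.Compl :=
  (P.toCompl ∘ₗ T).extendOfNorm P.toCompl

theorem extendOp_toCompl {T : P.carrier →ₗ[ℂ] P.carrier} (hT : ∃ C, ∀ ξ, ‖T ξ‖ ≤ C * ‖ξ‖)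
    (ξ : P.carrier) : P.extendOp T (P.toCompl ξ) = P.toCompl (T ξ) := by
  obtain ⟨C, hC⟩ := hT
  exact LinearMap.extendOfNorm_eq P.denseRange_toCompl
    ⟨C, fun ξ => by simpa [norm_toCompl] using hC ξ⟩ ξ

/-- Continuous maps on the completion agreeing on the image of `P` are equal. -/
theorem compl_ext {Z : Type*} [TopologicalSpace Z] [T2Space Z] {f g : P.Compl → Z}
    (hf : Continuous f) (hg : Continuous g) (h : ∀ ξ, f (P.toCompl ξ) = g (P.toCompl ξ))
    (z : P.Compl) : f z = g z :=
  congrFun (P.denseRange_toCompl.equalizer hf hg (funext h)) z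

theorem compl_ext₂ {Z : Type*} [TopologicalSpace Z] [T2Space Z] {f g : P.Compl → P.Compl → Z}
    (hf : Continuous fun p : P.Compl × P.Compl => f p.1 p.2)
    (hg : Continuous fun p : P.Compl × P.Compl => g p.1 p.2)
    (h : ∀ ξ η, f (P.toCompl ξ) (P.toCompl η) = g (P.toCompl ξ) (P.toCompl η))
    (z z' : P.Compl) : f z z' = g z z' :=
  P.compl_ext (f := fun z => f z z') (g := fun z => g z z')
    (hf.comp (by fun_prop : Continuous fun z => (z, z')))
    (hg.comp (by fun_prop : Continuous fun z => (z, z')))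
    (fun ξ => P.compl_ext (f := f (P.toCompl ξ)) (g := g (P.toCompl ξ))
      (hf.comp (by fun_prop : Continuous fun z => (P.toCompl ξ, z)))
      (hg.comp (by fun_prop : Continuous fun z => (P.toCompl ξ, z))) (h ξ) z') z

theorem extendOp_add {T T' : P.carrier →ₗ[ℂ] P.carrier} (hT : ∃ C, ∀ ξ, ‖T ξ‖ ≤ C * ‖ξ‖)
    (hT' : ∃ C, ∀ ξ, ‖T' ξ‖ ≤ C * ‖ξ‖) (h : ∃ C, ∀ ξ, ‖(T + T') ξ‖ ≤ C * ‖ξ‖) (z : P.Compl) :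
    P.extendOp (T + T') z = P.extendOp T z + P.extendOp T' z := by
  refine P.compl_ext (f := P.extendOp (T + T')) (g := fun z => P.extendOp T z + P.extendOp T' z)
    (ContinuousLinearMap.continuous _)
    ((ContinuousLinearMap.continuous _).add (ContinuousLinearMap.continuous _)) (fun ξ => ?_) z
  rw [P.extendOp_toCompl h, P.extendOp_toCompl hT, P.extendOp_toCompl hT', LinearMap.add_apply,
    map_add]

theorem extendOp_smul {T : P.carrier →ₗ[ℂ] P.carrier} (c : ℂ) (hT : ∃ C, ∀ ξ, ‖T ξ‖ ≤ C * ‖ξ‖)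
    (h : ∃ C, ∀ ξ, ‖(c • T) ξ‖ ≤ C * ‖ξ‖) (z : P.Compl) :
    P.extendOp (c • T) z = c • P.extendOp T z := by
  refine P.compl_ext (f := P.extendOp (c • T)) (g := fun z => c • P.extendOp T z)
    (ContinuousLinearMap.continuous _)
    ((ContinuousLinearMap.continuous _).const_smul c) (fun ξ => ?_) z
  rw [P.extendOp_toCompl h, P.extendOp_toCompl hT, LinearMap.smul_apply, map_smul]

/-- Extension of an action by bounded operators to the completion. -/
noncomputable def extendAct {D : Type u} [NonUnitalCStarAlgebra D]
    (T : D →ₗ[ℂ] P.carrier →ₗ[ℂ] P.carrier) (hT : ∀ d ξ, ‖T d ξ‖ ≤ ‖d‖ * ‖ξ‖) :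
    D →ₗ[ℂ] P.Compl →ₗ[ℂ] P.Compl where
  toFun d := (P.extendOp (T d)).toLinearMap
  map_add' d e := by
    ext z
    have h : ∃ C, ∀ ξ, ‖(T d + T e) ξ‖ ≤ C * ‖ξ‖ :=
      ⟨‖d + e‖, fun ξ => by simpa only [map_add] using hT (d + e) ξ⟩
    rw [map_add]
    exact P.extendOp_add ⟨_, hT d⟩ ⟨_, hT e⟩ h z
  map_smul' c d := by
    ext z
    have h : ∃ C, ∀ ξ, ‖(c • T d) ξ‖ ≤ C * ‖ξ‖ :=
      ⟨‖c • d‖, fun ξ => by simpa only [map_smul] using hT (c • d) ξ⟩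
    rw [map_smul]
    exact P.extendOp_smul c ⟨_, hT d⟩ h z

theorem extendAct_toCompl {D : Type u} [NonUnitalCStarAlgebra D]
    {T : D →ₗ[ℂ] P.carrier →ₗ[ℂ] P.carrier} (hT : ∀ d ξ, ‖T d ξ‖ ≤ ‖d‖ * ‖ξ‖)
    (d : D) (ξ : P.carrier) : P.extendAct T hT d (P.toCompl ξ) = P.toCompl (T d ξ) :=
  P.extendOp_toCompl ⟨_, hT d⟩ ξ

theorem continuous_extendAct {D : Type u} [NonUnitalCStarAlgebra D]
    {T : D →ₗ[ℂ] P.carrier →ₗ[ℂ] P.carrier} (hT : ∀ d ξ, ‖T d ξ‖ ≤ ‖d‖ * ‖ξ‖) (d : D) :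
    Continuous (P.extendAct T hT d) :=
  (P.extendOp (T d)).continuous

theorem extendInner_toCompl (ξ η : P.carrier) :
    (P.inner ξ).extendOfNorm P.toCompl (P.toCompl η) = P.inner ξ η :=
  LinearMap.extendOfNorm_eq P.denseRange_toCompl
    ⟨‖ξ‖, fun η => by simpa [norm_toCompl] using P.norm_inner_le ξ η⟩ η

/-- Extension of the inner product to the completion in the second variable. -/
noncomputable def innerAux : P.carrier →ₗ⋆[ℂ] P.Compl →L[ℂ] B where
  toFun ξ := (P.inner ξ).extendOfNorm P.toCompl
  map_add' ξ ξ' := by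
    refine ContinuousLinearMap.ext fun z => ?_
    refine P.compl_ext (ContinuousLinearMap.continuous _) (ContinuousLinearMap.continuous _)
      (fun η => ?_) z
    rw [_root_.add_apply]
    simp only [extendInner_toCompl]
    rw [map_add, LinearMap.add_apply]
  map_smul' c ξ := by
    refine ContinuousLinearMap.ext fun z => ?_
    refine P.compl_ext (ContinuousLinearMap.continuous _) (ContinuousLinearMap.continuous _)
      (fun η => ?_) z
    rw [_root_.smul_apply]
    simp only [extendInner_toCompl]
    rw [map_smulₛₗ, LinearMap.smul_apply]

theorem innerAux_toCompl (ξ η : P.carrier) : P.innerAux ξ (P.toCompl η) = P.inner ξ η :=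
  P.extendInner_toCompl ξ η

theorem norm_innerAux_le (ξ : P.carrier) : ‖P.innerAux ξ‖ ≤ 1 * ‖P.toCompl ξ‖ := by
  rw [one_mul, norm_toCompl]
  exact LinearMap.opNorm_extendOfNorm_le P.denseRange_toCompl (norm_nonneg _)
    fun η => by simpa [norm_toCompl] using P.norm_inner_le ξ η

/-- The inner product of the completion as a continuous sesquilinear map. -/
noncomputable def innerL : P.Compl →L⋆[ℂ] P.Compl →L[ℂ] B := P.innerAux.extendOfNorm P.toCompl

theorem innerL_toCompl (ξ η : P.carrier) :
    P.innerL (P.toCompl ξ) (P.toCompl η) = P.inner ξ η := by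
  rw [innerL, LinearMap.extendOfNorm_eq P.denseRange_toCompl ⟨1, P.norm_innerAux_le⟩,
    innerAux_toCompl]

theorem continuous_innerL {Z : Type*} [TopologicalSpace Z] {f g : Z → P.Compl}
    (hf : Continuous f) (hg : Continuous g) : Continuous fun z => P.innerL (f z) (g z) :=
  (P.innerL.continuous.comp hf).clm_apply hg

/-- The correspondence obtained by separation and completion. -/
noncomputable def completion : Correspondence.{u} A B where
  carrier := P.Compl
  rsmul := P.extendAct P.rsmul P.norm_rsmul_le
  rsmul_mul b c z := by
    refine P.compl_ext (P.continuous_extendAct _ _)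
      ((P.continuous_extendAct _ _).comp (P.continuous_extendAct _ _)) (fun ξ => ?_) z
    simp only [Function.comp_apply, extendAct_toCompl, P.rsmul_mul]
  inner := (ContinuousLinearMap.coeLM ℂ) ∘ₛₗ P.innerL.toLinearMap
  inner_rsmul z z' b := by
    refine P.compl_ext₂ (f := fun z z' => P.innerL z (P.extendAct P.rsmul P.norm_rsmul_le b z'))
      (g := fun z z' => P.innerL z z' * b)
      (P.continuous_innerL continuous_fst
        ((P.continuous_extendAct P.norm_rsmul_le b).comp continuous_snd))
      ((P.continuous_innerL continuous_fst continuous_snd).mul continuous_const)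
      (fun ξ η => ?_) z z'
    simp only [extendAct_toCompl, innerL_toCompl, P.inner_rsmul]
  star_inner z z' := by
    refine P.compl_ext₂ (f := fun z z' => star (P.innerL z z')) (g := fun z z' => P.innerL z' z)
      (P.continuous_innerL continuous_fst continuous_snd).star
      (P.continuous_innerL continuous_snd continuous_fst) (fun ξ η => ?_) z z'
    simp only [innerL_toCompl, P.star_inner]
  inner_self_pos z := by
    refine P.denseRange_toCompl.induction_on (p := fun z => IsPos (P.innerL z z)) z
      (isClosed_isPos.preimage (P.continuous_innerL continuous_id continuous_id)) fun ξ => ?_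
    rw [innerL_toCompl]
    exact P.inner_self_pos ξ
  norm_sq z := by
    refine P.compl_ext (f := fun z => ‖z‖ ^ 2) (g := fun z => ‖P.innerL z z‖)
      (continuous_norm.pow 2) (P.continuous_innerL continuous_id continuous_id).norm
      (fun ξ => ?_) z
    simp only [innerL_toCompl, norm_toCompl, P.norm_sq]
  lsmul := P.extendAct P.lsmul P.norm_lsmul_le
  lsmul_mul a b z := by
    refine P.compl_ext (P.continuous_extendAct _ _)
      ((P.continuous_extendAct _ _).comp (P.continuous_extendAct _ _)) (fun ξ => ?_) z
    simp only [Function.comp_apply, extendAct_toCompl, P.lsmul_mul]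
  inner_lsmul a z z' := by
    refine P.compl_ext₂ (f := fun z z' => P.innerL (P.extendAct P.lsmul P.norm_lsmul_le a z) z')
      (g := fun z z' => P.innerL z (P.extendAct P.lsmul P.norm_lsmul_le (star a) z'))
      (P.continuous_innerL ((P.continuous_extendAct P.norm_lsmul_le a).comp continuous_fst)
        continuous_snd)
      (P.continuous_innerL continuous_fst
        ((P.continuous_extendAct P.norm_lsmul_le (star a)).comp continuous_snd))
      (fun ξ η => ?_) z z'
    simp only [extendAct_toCompl, innerL_toCompl, P.inner_lsmul]

end PreCorrespondence

namespace Correspondence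

variable {A B C : Type u} [NonUnitalCStarAlgebra A] [NonUnitalCStarAlgebra B]
  [NonUnitalCStarAlgebra C]

theorem inner_rsmul_left (X : Correspondence.{u} A B) (ξ η : X.carrier) (b : B) :
    X.inner (X.rsmul b ξ) η = star b * X.inner ξ η := by
  rw [← X.star_inner, X.inner_rsmul, star_mul, X.star_inner]

theorem inner_lsmul_eq (X : Correspondence.{u} A B) (a : A) (ξ η : X.carrier) :
    X.inner ξ (X.lsmul a η) = X.inner (X.lsmul (star a) ξ) η := by
  rw [X.inner_lsmul, star_star]

section Tensor

variable (X : Correspondence.{u} A B) (Y : Correspondence.{u} B C)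

/-- The sesquilinear form on the algebraic tensor product over `ℂ` with
`⟪ξ₁ ⊗ η₁, ξ₂ ⊗ η₂⟫ = ⟪η₁, φ_Y(⟪ξ₁, ξ₂⟫) η₂⟫`. -/
noncomputable def tensorInner :
    X.carrier ⊗[ℂ] Y.carrier →ₗ⋆[ℂ] X.carrier ⊗[ℂ] Y.carrier →ₗ[ℂ] C :=
  TensorProduct.lift <| LinearMap.mk₂'ₛₗ (starRingEnd ℂ) (starRingEnd ℂ)
    (fun ξ₁ η₁ => TensorProduct.lift <| LinearMap.mk₂ ℂ
      (fun ξ₂ η₂ => Y.inner η₁ (Y.lsmul (X.inner ξ₁ ξ₂) η₂))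
      (by intros; simp) (by intros; simp) (by intros; simp) (by intros; simp))
    (by intros; apply TensorProduct.ext'; intros; simp)
    (by intros; apply TensorProduct.ext'; intros; simp)
    (by intros; apply TensorProduct.ext'; intros; simp)
    (by intros; apply TensorProduct.ext'; intros; simp)

theorem tensorInner_tmul (ξ₁ ξ₂ : X.carrier) (η₁ η₂ : Y.carrier) :
    tensorInner X Y (ξ₁ ⊗ₜ η₁) (ξ₂ ⊗ₜ η₂) = Y.inner η₁ (Y.lsmul (X.inner ξ₁ ξ₂) η₂) := rfl

theorem tensorInner_self_pos (t : X.carrier ⊗[ℂ] Y.carrier) : IsPos (tensorInner X Y t t) := by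
  obtain ⟨S, rfl⟩ := TensorProduct.exists_finset t
  obtain ⟨T, hT⟩ := exists_matrix_factor (ι := S) (fun i j => X.inner i.1.1 j.1.1)
    (fun i j => X.star_inner _ _) (fun v => by
      convert X.inner_self_pos (∑ i : S, X.rsmul (v i) i.1.1) using 1
      simp only [map_sum, LinearMap.sum_apply, X.inner_rsmul, X.inner_rsmul_left]
      rw [Finset.sum_comm])
  rw [← Finset.sum_coe_sort S]
  have h : tensorInner X Y (∑ i : S, i.1.1 ⊗ₜ i.1.2) (∑ i : S, i.1.1 ⊗ₜ i.1.2)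
      = ∑ k, Y.inner (∑ i : S, Y.lsmul (T k i) i.1.2) (∑ i : S, Y.lsmul (T k i) i.1.2) := by
    simp only [map_sum, LinearMap.sum_apply, tensorInner_tmul, hT, Y.inner_lsmul, Y.lsmul_mul]
    calc _ = ∑ j : S, ∑ k : S, ∑ i : S,
          Y.inner i.1.2 (Y.lsmul (star (T k i)) (Y.lsmul (T k j) j.1.2)) :=
          Finset.sum_congr rfl fun j _ => Finset.sum_comm
      _ = _ := Finset.sum_comm
  rw [h]
  exact IsPos.sum fun k _ => Y.inner_self_pos _

/-- The algebraic tensor product with its semi-inner product and the actions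
`(ξ ⊗ η) · c = ξ ⊗ (η · c)` and `φ(a) (ξ ⊗ η) = (φ(a) ξ) ⊗ η`. -/
noncomputable def preTensor : PreCorrespondence.{u} A C where
  carrier := X.carrier ⊗[ℂ] Y.carrier
  rsmul := LinearMap.lTensorHom X.carrier ∘ₗ Y.rsmul
  rsmul_mul b c t := by
    induction t with
    | zero => simp only [map_zero]
    | add s t hs ht => simp only [map_add, hs, ht]
    | tmul ξ η => simp [Y.rsmul_mul]
  inner := tensorInner X Y
  inner_rsmul t t' c := by
    induction t with
    | zero => simp
    | add s t hs ht => simp only [map_add, LinearMap.add_apply, hs, ht, add_mul]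
    | tmul ξ η =>
      induction t' with
      | zero => simp
      | add s t hs ht => simp only [map_add, hs, ht, add_mul]
      | tmul ξ' η' =>
        simp [tensorInner_tmul, Y.inner_rsmul, Y.inner_lsmul_eq]
  star_inner t t' := by
    induction t with
    | zero => simp
    | add s t hs ht => simp only [map_add, LinearMap.add_apply, hs, ht, star_add]
    | tmul ξ η =>
      induction t' with
      | zero => simp
      | add s t hs ht => simp only [map_add, LinearMap.add_apply, hs, ht, star_add]
      | tmul ξ' η' =>
        rw [tensorInner_tmul, tensorInner_tmul, Y.star_inner, Y.inner_lsmul, X.star_inner]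
  inner_self_pos := tensorInner_self_pos X Y
  lsmul := LinearMap.rTensorHom Y.carrier ∘ₗ X.lsmul
  lsmul_mul a b t := by
    induction t with
    | zero => simp only [map_zero]
    | add s t hs ht => simp only [map_add, hs, ht]
    | tmul ξ η => simp [X.lsmul_mul]
  inner_lsmul a t t' := by
    induction t with
    | zero => simp
    | add s t hs ht => simp only [map_add, LinearMap.add_apply, hs, ht]
    | tmul ξ η =>
      induction t' with
      | zero => simp
      | add s t hs ht => simp only [map_add, hs, ht]
      | tmul ξ' η' => simp [tensorInner_tmul, X.inner_lsmul]

/-- The interior tensor product `X ⊗_B Y`: the Hausdorff completion of the algebraic tensor product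
over `ℂ` for the inner product `⟪ξ₁ ⊗ η₁, ξ₂ ⊗ η₂⟫ = ⟪η₁, φ_Y(⟪ξ₁, ξ₂⟫) η₂⟫`. The vectors
`(ξ · b) ⊗ η - ξ ⊗ φ_Y(b) η` have length zero, so they vanish in it. -/
noncomputable def tensor : Correspondence.{u} A C := (preTensor X Y).completion

/-- The canonical map from the algebraic to the interior tensor product. -/
noncomputable def toTensor : X.carrier ⊗[ℂ] Y.carrier →ₗ[ℂ] (tensor X Y).carrier :=
  (preTensor X Y).toCompl

/-- The elementary tensor `ξ ⊗ η` in the interior tensor product. -/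
noncomputable def tmul (ξ : X.carrier) (η : Y.carrier) : (tensor X Y).carrier :=
  toTensor X Y (ξ ⊗ₜ[ℂ] η)

theorem denseRange_toTensor : DenseRange (toTensor X Y) := (preTensor X Y).denseRange_toCompl

theorem inner_tmul (ξ₁ ξ₂ : X.carrier) (η₁ η₂ : Y.carrier) :
    (tensor X Y).inner (tmul X Y ξ₁ η₁) (tmul X Y ξ₂ η₂)
      = Y.inner η₁ (Y.lsmul (X.inner ξ₁ ξ₂) η₂) :=
  (preTensor X Y).innerL_toCompl _ _

theorem lsmul_tmul (a : A) (ξ : X.carrier) (η : Y.carrier) :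
    (tensor X Y).lsmul a (tmul X Y ξ η) = tmul X Y (X.lsmul a ξ) η :=
  (preTensor X Y).extendAct_toCompl (preTensor X Y).norm_lsmul_le a _

theorem rsmul_tmul (c : C) (ξ : X.carrier) (η : Y.carrier) :
    (tensor X Y).rsmul c (tmul X Y ξ η) = tmul X Y ξ (Y.rsmul c η) :=
  (preTensor X Y).extendAct_toCompl (preTensor X Y).norm_rsmul_le c _

theorem span_tmul_dense :
    Dense (Submodule.span ℂ (Set.range fun p : X.carrier × Y.carrier => tmul X Y p.1 p.2) :
      Set (tensor X Y).carrier) := by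
  refine (denseRange_toTensor X Y).mono ?_
  rintro _ ⟨t, rfl⟩
  rw [SetLike.mem_coe]
  induction t using TensorProduct.induction_on with
  | zero => rw [map_zero]; exact Submodule.zero_mem _
  | add s t hs ht => rw [map_add]; exact Submodule.add_mem _ hs ht
  | tmul ξ η => exact Submodule.subset_span ⟨(ξ, η), rfl⟩

/-- The tensor product is balanced over `B`. -/
theorem rsmul_tmul_eq_tmul_lsmul (b : B) (ξ : X.carrier) (η : Y.carrier) :
    tmul X Y (X.rsmul b ξ) η = tmul X Y ξ (Y.lsmul b η) := by
  set z := tmul X Y (X.rsmul b ξ) η - tmul X Y ξ (Y.lsmul b η) with hz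
  have h : (tensor X Y).inner z z = 0 := by
    rw [hz]
    simp only [map_sub, LinearMap.sub_apply, inner_tmul, X.inner_rsmul, X.inner_rsmul_left,
      Y.inner_lsmul, Y.lsmul_mul]
    simp
  have h2 := (tensor X Y).norm_sq z
  rw [h, norm_zero] at h2
  exact sub_eq_zero.1 (norm_eq_zero.1 (pow_eq_zero_iff two_ne_zero |>.1 h2))

end Tensor

/-- Unitary equivalence `X ≈ Y`: a unitary (a surjective map preserving the inner product) that
intertwines the left actions and the right actions. -/
def UnitarilyEquivalent (X Y : Correspondence.{u} A B) : Prop :=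
  ∃ U : X.carrier ≃ₗ[ℂ] Y.carrier,
    (∀ ξ η, Y.inner (U ξ) (U η) = X.inner ξ η) ∧
    (∀ a ξ, U (X.lsmul a ξ) = Y.lsmul a (U ξ)) ∧
    (∀ b ξ, U (X.rsmul b ξ) = Y.rsmul b (U ξ))

/-- `M` is an imprimitivity bimodule: there is a left inner product `⟪·, ·⟫_A` on `M`, linear in the
first variable, for which `M` is a left Hilbert `A`-module (positive, definite, complete) and
`⟪ξ, η⟫_A ζ = ξ ⟪η, ζ⟫_B`, and `M` is full on both sides. -/
def IsImprimitivityBimodule (M : Correspondence.{u} A B) : Prop :=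
  ∃ linner : M.carrier →ₗ[ℂ] M.carrier →ₗ⋆[ℂ] A,
    (∀ a ξ η, linner (M.lsmul a ξ) η = a * linner ξ η) ∧
    (∀ ξ η, star (linner ξ η) = linner η ξ) ∧
    (∀ ξ, IsPos (linner ξ ξ)) ∧
    (∀ ξ, linner ξ ξ = 0 → ξ = 0) ∧
    (∀ s : ℕ → M.carrier,
      (∀ ε > 0, ∃ N, ∀ m ≥ N, ∀ n ≥ N, ‖linner (s m - s n) (s m - s n)‖ < ε) →
        ∃ ξ, ∀ ε > 0, ∃ N, ∀ n ≥ N, ‖linner (s n - ξ) (s n - ξ)‖ < ε) ∧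
    (∀ ξ η ζ, M.lsmul (linner ξ η) ζ = M.rsmul (M.inner η ζ) ξ) ∧
    Dense (Submodule.span ℂ (Set.range fun p : M.carrier × M.carrier => linner p.1 p.2) : Set A) ∧
    Dense (Submodule.span ℂ (Set.range fun p : M.carrier × M.carrier => M.inner p.1 p.2) : Set B)

/-- `E.tensorPowSucc n` is the tensor power `E^{⊗ (n + 1)}`. -/
noncomputable def tensorPowSucc (E : Correspondence.{u} A A) : ℕ → Correspondence.{u} A A
  | 0 => E
  | n + 1 => (tensorPowSucc E n).tensor E

/-- Strong Morita equivalence: `E ⊗_A M ≈ M ⊗_B F` for some imprimitivity bimodule `M`. -/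
def StrongMoritaEquivalent (E : Correspondence.{u} A A) (F : Correspondence.{u} B B) : Prop :=
  ∃ M : Correspondence.{u} A B, M.IsImprimitivityBimodule ∧
    UnitarilyEquivalent (E.tensor M) (M.tensor F)

/-- Elementary strong shift equivalence: `E ≈ R ⊗_B S` and `F ≈ S ⊗_A R`. -/
def ElementaryStrongShiftEquivalent (E : Correspondence.{u} A A) (F : Correspondence.{u} B B) :
    Prop :=
  ∃ (R : Correspondence.{u} A B) (S : Correspondence.{u} B A),
    UnitarilyEquivalent E (R.tensor S) ∧ UnitarilyEquivalent F (S.tensor R)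

/-- Shift equivalence, with lag the positive integer `n + 1`. -/
def ShiftEquivalent (E : Correspondence.{u} A A) (F : Correspondence.{u} B B) : Prop :=
  ∃ (R : Correspondence.{u} A B) (S : Correspondence.{u} B A) (n : ℕ),
    UnitarilyEquivalent (E.tensorPowSucc n) (R.tensor S) ∧
    UnitarilyEquivalent (F.tensorPowSucc n) (S.tensor R) ∧
    UnitarilyEquivalent (S.tensor E) (F.tensor S) ∧
    UnitarilyEquivalent (E.tensor R) (R.tensor F)

end Correspondence

/-- A C*-algebra together with a C*-correspondence over it. -/
structure BundledCorrespondence where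
  algebra : Type u
  [nonUnitalCStarAlgebra : NonUnitalCStarAlgebra algebra]
  corr : Correspondence.{u} algebra algebra

attribute [instance] BundledCorrespondence.nonUnitalCStarAlgebra

/-- Strong shift equivalence: the transitive closure of elementary strong shift equivalence among
all C*-correspondences over all C*-algebras. -/
def Correspondence.StrongShiftEquivalent {A B : Type u} [NonUnitalCStarAlgebra A]
    [NonUnitalCStarAlgebra B] (E : Correspondence.{u} A A) (F : Correspondence.{u} B B) : Prop :=
  Relation.TransGen
    (fun S T : BundledCorrespondence.{u} => S.corr.ElementaryStrongShiftEquivalent T.corr)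
    ⟨A, E⟩ ⟨B, F⟩

end CStarCorr

namespace CStarCorr

open scoped TensorProduct ComplexConjugate

/-! A correspondence is determined up to unitary equivalence by a family with dense linear span,
together with its Gram matrix and the matrix coefficients of the left action on it
(`unitarilyEquivalent_of_denseSpan`). Congruence and associativity of the interior tensor product,
and its unit law, thus become identities between elementary tensors.

Let `M` implement a strong Morita equivalence, with dual `M*`. Take `R = M` and `S = F ⊗ M*`. Then
`R ⊗ S ≈ E ⊗ M ⊗ M* ≈ E` and `S ⊗ R = F ⊗ M* ⊗ M ≈ F`, because `M ⊗ M*` and `M* ⊗ M` have the matrix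
coefficients of the identity correspondences. These units only ever occur on the right, where they
can be cancelled (`tensor_right_unit`): right Hilbert modules are automatically nondegenerate,
whereas left actions may be degenerate.

An elementary strong shift equivalence is a strong one with a single step, and also a shift
equivalence of lag one: regroup `R ⊗ S ⊗ R` and `S ⊗ R ⊗ S`. Shift equivalence is transitive: since
`R` intertwines powers of `E` with powers of `F`, the pair `R ⊗ R'`, `S' ⊗ S` works and the lags
add. Induction along a chain gives the last implication. -/

/-- The linear span of the family `x` is dense. -/
def DenseSpan {ι V : Type*} [NormedAddCommGroup V] [NormedSpace ℂ V] (x : ι → V) : Prop :=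
  Dense (Submodule.span ℂ (Set.range x) : Set V)

/-! ### Families with dense span -/

section DenseSpan

variable {ι V W : Type*} [NormedAddCommGroup V] [NormedSpace ℂ V] [NormedAddCommGroup W]
  [NormedSpace ℂ W]

theorem DenseSpan.mem_of_isClosed {x : ι → V} (hx : DenseSpan x) {S : Submodule ℂ V}
    (hS : IsClosed (S : Set V)) (h : ∀ i, x i ∈ S) (v : V) : v ∈ S := by
  have h1 : Submodule.span ℂ (Set.range x) ≤ S :=
    Submodule.span_le.2 (by rintro _ ⟨i, rfl⟩; exact h i)
  exact closure_minimal h1 hS (hx v)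

theorem DenseSpan.map_mem {x : ι → V} (hx : DenseSpan x) (L : V →L[ℂ] W) {S : Submodule ℂ W}
    (hS : IsClosed (S : Set W)) (h : ∀ i, L (x i) ∈ S) (v : V) : L v ∈ S :=
  hx.mem_of_isClosed (S := S.comap L.toLinearMap) (hS.preimage L.continuous) h v

/-- Transfers density: it is enough to approximate one family already known to generate. -/
theorem DenseSpan.of_forall_mem {κ : Type*} {x : ι → V} {y : κ → V} (hx : DenseSpan x)
    (h : ∀ i, x i ∈ (Submodule.span ℂ (Set.range y)).topologicalClosure) : DenseSpan y := by
  intro v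
  have := hx.mem_of_isClosed (Submodule.isClosed_topologicalClosure _) h v
  rwa [← SetLike.mem_coe, Submodule.topologicalClosure_coe] at this

theorem DenseSpan.id : DenseSpan (fun v : V => v) := by
  intro v
  exact subset_closure (Submodule.subset_span ⟨v, rfl⟩)

theorem DenseSpan.mem_topologicalClosure (x : ι → V) (i : ι) :
    x i ∈ (Submodule.span ℂ (Set.range x)).topologicalClosure :=
  Submodule.le_topologicalClosure _ (Submodule.subset_span ⟨i, rfl⟩)

theorem DenseSpan.denseRange {x : ι → V} (hx : DenseSpan x) :
    DenseRange (Finsupp.linearCombination ℂ x) := by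
  rw [DenseRange, ← LinearMap.coe_range, Finsupp.range_linearCombination]
  exact hx

theorem DenseSpan.clm_eq {x : ι → V} (hx : DenseSpan x) {L L' : V →L[ℂ] W}
    (h : ∀ i, L (x i) = L' (x i)) (v : V) : L v = L' v :=
  DFunLike.congr_fun (ContinuousLinearMap.ext_on hx (by rintro _ ⟨i, rfl⟩; exact h i)) v

end DenseSpan

namespace Correspondence

variable {A B C D : Type u} [NonUnitalCStarAlgebra A] [NonUnitalCStarAlgebra B]
  [NonUnitalCStarAlgebra C] [NonUnitalCStarAlgebra D]

/-! ### Norm bounds and separation of vectors by inner products -/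

section Basic

variable (X : Correspondence.{u} A B)

/-- A correspondence, with its completeness and its norm forgotten. -/
def toPreCorrespondence : PreCorrespondence.{u} A B where
  carrier := X.carrier
  rsmul := X.rsmul
  rsmul_mul := X.rsmul_mul
  inner := X.inner
  inner_rsmul := X.inner_rsmul
  star_inner := X.star_inner
  inner_self_pos := X.inner_self_pos
  lsmul := X.lsmul
  lsmul_mul := X.lsmul_mul
  inner_lsmul := X.inner_lsmul

theorem norm_inner_le (ξ η : X.carrier) : ‖X.inner ξ η‖ ≤ ‖ξ‖ * ‖η‖ := by
  refine (le_abs_self _).trans (abs_le_of_sq_le_sq ?_ (by positivity))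
  rw [mul_pow, X.norm_sq, X.norm_sq]
  exact X.toPreCorrespondence.norm_inner_sq_le ξ η

theorem norm_lsmul_le (a : A) (ξ : X.carrier) : ‖X.lsmul a ξ‖ ≤ ‖a‖ * ‖ξ‖ := by
  -- The seminorm built from the inner product and the given norm are different instances on one
  -- space; `norm_sq` forces their values to agree.
  have h : ∀ η : X.carrier, X.toPreCorrespondence.instNorm.norm η = ‖η‖ := fun η =>
    (congrArg Real.sqrt (X.norm_sq η).symm).trans (Real.sqrt_sq (norm_nonneg η))
  exact (h _).symm.trans_le
    ((X.toPreCorrespondence.norm_lsmul_le a ξ).trans_eq (congrArg (‖a‖ * ·) (h ξ)))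

theorem norm_rsmul_le (b : B) (ξ : X.carrier) : ‖X.rsmul b ξ‖ ≤ ‖b‖ * ‖ξ‖ := by
  have h : ∀ η : X.carrier, X.toPreCorrespondence.instNorm.norm η = ‖η‖ := fun η =>
    (congrArg Real.sqrt (X.norm_sq η).symm).trans (Real.sqrt_sq (norm_nonneg η))
  exact (h _).symm.trans_le
    ((X.toPreCorrespondence.norm_rsmul_le b ξ).trans_eq (congrArg (‖b‖ * ·) (h ξ)))

/-- The functional `⟪ξ, ·⟫`. -/
noncomputable def innerCLM (ξ : X.carrier) : X.carrier →L[ℂ] B :=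
  (X.inner ξ).mkContinuous ‖ξ‖ (X.norm_inner_le ξ)

theorem eq_zero_of_inner_self {ξ : X.carrier} (h : X.inner ξ ξ = 0) : ξ = 0 := by
  have h2 := X.norm_sq ξ
  rw [h, norm_zero] at h2
  exact norm_eq_zero.1 (pow_eq_zero_iff two_ne_zero |>.1 h2)

theorem inner_left_eq {ι : Type*} {x : ι → X.carrier} (hx : DenseSpan x) {ξ η : X.carrier}
    (h : ∀ i, X.inner (x i) ξ = X.inner (x i) η) (ζ : X.carrier) :
    X.inner ζ ξ = X.inner ζ η := by
  rw [← X.star_inner ξ, ← X.star_inner η]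
  -- After taking adjoints the varying vector sits in the linear slot, where the density argument
  -- for continuous linear maps applies.
  congr 1
  exact hx.clm_eq (L := X.innerCLM ξ) (L' := X.innerCLM η) (fun i => by
    have := congrArg star (h i)
    rwa [X.star_inner, X.star_inner] at this) ζ

theorem eq_of_inner {ι : Type*} {x : ι → X.carrier} (hx : DenseSpan x) {ξ η : X.carrier}
    (h : ∀ i, X.inner (x i) ξ = X.inner (x i) η) : ξ = η := by
  refine sub_eq_zero.1 (X.eq_zero_of_inner_self ?_)
  rw [map_sub (X.inner (ξ - η)), X.inner_left_eq hx h, sub_self]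

end Basic

/-! ### Unitaries constructed from Gram matrices -/

/-- Two correspondences that have generating families with the same inner products and the same
matrix coefficients of the left action are unitarily equivalent. -/
theorem unitarilyEquivalent_of_denseSpan {X Y : Correspondence.{u} A B} {ι : Type*}
    {x : ι → X.carrier} {y : ι → Y.carrier} (hx : DenseSpan x) (hy : DenseSpan y)
    (hxy : ∀ i j, X.inner (x i) (x j) = Y.inner (y i) (y j))
    (hl : ∀ a i j, X.inner (x i) (X.lsmul a (x j)) = Y.inner (y i) (Y.lsmul a (y j))) :
    UnitarilyEquivalent X Y := by
  set f := Finsupp.linearCombination ℂ x with hf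
  set g := Finsupp.linearCombination ℂ y with hg
  -- The Gram matrix determines the norm of every finite combination, so `f c ↦ g c` is well defined
  -- and isometric between dense subspaces.
  have hfg : ∀ c, ‖f c‖ = ‖g c‖ := fun c => by
    have h : X.inner (f c) (f c) = Y.inner (g c) (g c) := by
      simp only [hf, hg, Finsupp.linearCombination_apply, Finsupp.sum, map_sum, map_smulₛₗ,
        LinearMap.sum_apply, LinearMap.smul_apply, hxy]
    rw [← sq_eq_sq₀ (norm_nonneg _) (norm_nonneg _), X.norm_sq, Y.norm_sq, h]
  let U : X.carrier →L[ℂ] Y.carrier := g.extendOfNorm f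
  let V : Y.carrier →L[ℂ] X.carrier := f.extendOfNorm g
  have hU : ∀ i, U (x i) = y i := fun i => by
    have := LinearMap.extendOfNorm_eq (f := g) hx.denseRange ⟨1, fun c => by rw [one_mul, hfg]⟩
      (Finsupp.single i 1)
    simpa [hf, hg] using this
  have hV : ∀ i, V (y i) = x i := fun i => by
    have := LinearMap.extendOfNorm_eq (f := f) hy.denseRange ⟨1, fun c => by rw [one_mul, hfg]⟩
      (Finsupp.single i 1)
    simpa [hf, hg] using this
  have hUV : ∀ η, U (V η) = η := hy.clm_eq (L := U ∘L V) (L' := .id ℂ _) (fun i => by simp [hU, hV])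
  have hVU : ∀ ξ, V (U ξ) = ξ := hx.clm_eq (L := V ∘L U) (L' := .id ℂ _) (fun i => by simp [hU, hV])
  have h1 : ∀ i ξ, Y.inner (y i) (U ξ) = X.inner (x i) ξ := fun i =>
    hx.clm_eq (L := Y.innerCLM (y i) ∘L U) (L' := X.innerCLM (x i)) (fun j => by
      change Y.inner (y i) (U (x j)) = X.inner (x i) (x j)
      rw [hU, hxy])
  have h2 : ∀ ξ η, Y.inner (U ξ) (U η) = X.inner ξ η := fun ξ η => by
    rw [← Y.star_inner, ← X.star_inner]
    congr 1
    refine hx.clm_eq (L := Y.innerCLM (U η) ∘L U) (L' := X.innerCLM η) (fun i => ?_) ξ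
    change Y.inner (U η) (U (x i)) = X.inner η (x i)
    rw [← Y.star_inner, ← X.star_inner, hU, h1]
  have h3 : ∀ a i ξ, X.inner (x i) (X.lsmul a ξ) = Y.inner (y i) (Y.lsmul a (U ξ)) := by
    intro a i ξ
    rw [X.inner_lsmul_eq, Y.inner_lsmul_eq]
    refine hx.clm_eq (L := X.innerCLM _) (L' := Y.innerCLM (Y.lsmul (star a) (y i)) ∘L U)
      (fun j => ?_) ξ
    change X.inner _ (x j) = Y.inner _ (U (x j))
    rw [hU, ← X.inner_lsmul_eq, ← Y.inner_lsmul_eq, hl]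
  refine ⟨LinearEquiv.ofLinearMap U.toLinearMap V.toLinearMap (LinearMap.ext hUV)
    (LinearMap.ext hVU), h2, fun a ξ => ?_, fun b ξ => ?_⟩
  · change U (X.lsmul a ξ) = Y.lsmul a (U ξ)
    refine Y.eq_of_inner hy fun i => ?_
    rw [h1, h3]
  · change U (X.rsmul b ξ) = Y.rsmul b (U ξ)
    -- Nothing was assumed about the right action: inner products against generators already
    -- determine it, by `inner_rsmul`.
    refine Y.eq_of_inner hy fun i => ?_
    rw [h1, Y.inner_rsmul, h1, X.inner_rsmul]

namespace UnitarilyEquivalent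

@[refl]
theorem refl (X : Correspondence.{u} A B) : UnitarilyEquivalent X X :=
  ⟨.refl ℂ _, fun _ _ => rfl, fun _ _ => rfl, fun _ _ => rfl⟩

@[symm]
theorem symm {X Y : Correspondence.{u} A B} (h : UnitarilyEquivalent X Y) :
    UnitarilyEquivalent Y X := by
  obtain ⟨U, hi, hl, hr⟩ := h
  refine ⟨U.symm, fun ξ η => ?_, fun a ξ => ?_, fun b ξ => ?_⟩
  · rw [← hi, U.apply_symm_apply, U.apply_symm_apply]
  · rw [LinearEquiv.symm_apply_eq, hl, U.apply_symm_apply]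
  · rw [LinearEquiv.symm_apply_eq, hr, U.apply_symm_apply]

@[trans]
theorem trans {X Y Z : Correspondence.{u} A B} (h : UnitarilyEquivalent X Y)
    (h' : UnitarilyEquivalent Y Z) : UnitarilyEquivalent X Z := by
  obtain ⟨U, hi, hl, hr⟩ := h
  obtain ⟨V, hi', hl', hr'⟩ := h'
  exact ⟨U.trans V, fun ξ η => by simp [hi, hi'], fun a ξ => by simp [hl, hl'],
    fun b ξ => by simp [hr, hr']⟩

end UnitarilyEquivalent

/-! ### Interior tensor products: generators, congruence, associativity -/

section TensorLemmas

variable (X : Correspondence.{u} A B) (Y : Correspondence.{u} B C)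

theorem norm_tmul_le (ξ : X.carrier) (η : Y.carrier) : ‖tmul X Y ξ η‖ ≤ ‖ξ‖ * ‖η‖ := by
  refine (le_abs_self _).trans (abs_le_of_sq_le_sq ?_ (by positivity))
  rw [(tensor X Y).norm_sq, inner_tmul]
  calc _ ≤ ‖η‖ * ‖Y.lsmul (X.inner ξ ξ) η‖ := Y.norm_inner_le _ _
    _ ≤ ‖η‖ * (‖ξ‖ ^ 2 * ‖η‖) := by
      rw [X.norm_sq]
      gcongr
      exact Y.norm_lsmul_le _ _
    _ = _ := by ring

/-- `ξ ↦ ξ ⊗ η` -/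
noncomputable def tmulLeft (η : Y.carrier) : X.carrier →L[ℂ] (tensor X Y).carrier :=
  (toTensor X Y ∘ₗ (TensorProduct.mk ℂ X.carrier Y.carrier).flip η).mkContinuous ‖η‖
    fun ξ => (norm_tmul_le X Y ξ η).trans_eq (mul_comm _ _)

/-- `η ↦ ξ ⊗ η` -/
noncomputable def tmulRight (ξ : X.carrier) : Y.carrier →L[ℂ] (tensor X Y).carrier :=
  (toTensor X Y ∘ₗ TensorProduct.mk ℂ X.carrier Y.carrier ξ).mkContinuous ‖ξ‖
    fun η => norm_tmul_le X Y ξ η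

theorem denseSpan_tmul_self : DenseSpan fun p : X.carrier × Y.carrier => tmul X Y p.1 p.2 :=
  span_tmul_dense X Y

variable {X Y}

/-- Elementary tensors are continuous in each variable separately, so the two factors can be
approximated one after the other. -/
theorem denseSpan_tmul {ι κ : Type*} {x : ι → X.carrier} {y : κ → Y.carrier} (hx : DenseSpan x)
    (hy : DenseSpan y) : DenseSpan fun p : ι × κ => tmul X Y (x p.1) (y p.2) := by
  refine DenseSpan.of_forall_mem (x := fun p : X.carrier × Y.carrier => tmul X Y p.1 p.2)
    (denseSpan_tmul_self X Y) fun ⟨ξ, η⟩ => ?_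
  refine hx.map_mem (tmulLeft X Y η) (Submodule.isClosed_topologicalClosure _) (fun i => ?_) ξ
  exact hy.map_mem (tmulRight X Y (x i)) (Submodule.isClosed_topologicalClosure _)
    (fun k => DenseSpan.mem_topologicalClosure _ (i, k)) η

end TensorLemmas

theorem UnitarilyEquivalent.tensor_congr {X X' : Correspondence.{u} A B}
    {Y Y' : Correspondence.{u} B C} (h : UnitarilyEquivalent X X')
    (h' : UnitarilyEquivalent Y Y') : UnitarilyEquivalent (X.tensor Y) (X'.tensor Y') := by
  obtain ⟨U, hi, hl, hr⟩ := h
  obtain ⟨V, hi', hl', hr'⟩ := h'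
  refine unitarilyEquivalent_of_denseSpan
    (x := fun p : X.carrier × Y.carrier => tmul X Y p.1 p.2)
    (y := fun p : X.carrier × Y.carrier => tmul X' Y' (U p.1) (V p.2))
    (denseSpan_tmul_self X Y) ?_ (fun p q => ?_) (fun a p q => ?_)
  -- Surjectivity of `U` and `V` makes every elementary tensor of the target a member of the family.
  · refine DenseSpan.of_forall_mem (x := fun p : X'.carrier × Y'.carrier => tmul X' Y' p.1 p.2)
      (denseSpan_tmul_self X' Y') fun ⟨ξ, η⟩ => ?_
    have := DenseSpan.mem_topologicalClosure
      (fun p : X.carrier × Y.carrier => tmul X' Y' (U p.1) (V p.2)) (U.symm ξ, V.symm η)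
    simpa only [LinearEquiv.apply_symm_apply] using this
  · rw [inner_tmul, inner_tmul, hi, ← hl', hi']
  · rw [lsmul_tmul, lsmul_tmul, inner_tmul, inner_tmul, ← hl, hi, ← hl', hi']

/-- The interior tensor product is associative. -/
theorem tensor_assoc (X : Correspondence.{u} A B) (Y : Correspondence.{u} B C)
    (Z : Correspondence.{u} C D) :
    UnitarilyEquivalent ((X.tensor Y).tensor Z) (X.tensor (Y.tensor Z)) := by
  refine unitarilyEquivalent_of_denseSpan
    (x := fun p : (X.carrier × Y.carrier) × Z.carrier => tmul _ Z (tmul X Y p.1.1 p.1.2) p.2)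
    (y := fun p : (X.carrier × Y.carrier) × Z.carrier => tmul X _ p.1.1 (tmul Y Z p.1.2 p.2))
    (denseSpan_tmul (X := X.tensor Y) (x := fun p : X.carrier × Y.carrier => tmul X Y p.1 p.2)
      (y := fun ζ : Z.carrier => ζ) (denseSpan_tmul_self X Y) .id)
    ?_ (fun p q => ?_) (fun a p q => ?_)
  · refine DenseSpan.of_forall_mem
      (x := fun p : X.carrier × (Y.carrier × Z.carrier) => tmul X _ p.1 (tmul Y Z p.2.1 p.2.2))
      (denseSpan_tmul (Y := Y.tensor Z) (x := fun ξ : X.carrier => ξ)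
        (y := fun p : Y.carrier × Z.carrier => tmul Y Z p.1 p.2) .id
        (denseSpan_tmul_self Y Z)) fun p => ?_
    exact DenseSpan.mem_topologicalClosure
      (fun p : (X.carrier × Y.carrier) × Z.carrier => tmul X _ p.1.1 (tmul Y Z p.1.2 p.2))
      ((p.1, p.2.1), p.2.2)
  -- For either bracketing the inner product is `⟪ζ, ⟪η, ⟪ξ, ξ'⟫ η'⟫ ζ'⟫`, with the actions written
  -- by juxtaposition.
  · simp only [inner_tmul, lsmul_tmul]
  · simp only [inner_tmul, lsmul_tmul]

/-! ### Tensor powers and intertwining correspondences -/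

section Powers

instance : Trans (UnitarilyEquivalent (A := A) (B := B)) (UnitarilyEquivalent (A := A) (B := B))
    (UnitarilyEquivalent (A := A) (B := B)) :=
  ⟨UnitarilyEquivalent.trans⟩

theorem UnitarilyEquivalent.tensor_left {X X' : Correspondence.{u} A B}
    (h : UnitarilyEquivalent X X') (Y : Correspondence.{u} B C) :
    UnitarilyEquivalent (X.tensor Y) (X'.tensor Y) :=
  h.tensor_congr (.refl Y)

theorem UnitarilyEquivalent.tensor_right (X : Correspondence.{u} A B)
    {Y Y' : Correspondence.{u} B C} (h : UnitarilyEquivalent Y Y') :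
    UnitarilyEquivalent (X.tensor Y) (X.tensor Y') :=
  (UnitarilyEquivalent.refl X).tensor_congr h

/-- The index is one less than the exponent, so `(m + 1) + (n + 1)` has index `m + n + 1`. -/
theorem tensorPowSucc_add (E : Correspondence.{u} A A) (m n : ℕ) :
    UnitarilyEquivalent (E.tensorPowSucc (m + n + 1))
      ((E.tensorPowSucc m).tensor (E.tensorPowSucc n)) := by
  induction n with
  | zero => exact .refl _
  | succ n ih => exact (ih.tensor_left E).trans (tensor_assoc _ _ E)

/-- A correspondence intertwining `E` and `F` intertwines their tensor powers. -/
theorem UnitarilyEquivalent.tensorPowSucc_intertwine {E : Correspondence.{u} A A}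
    {F : Correspondence.{u} B B} {R : Correspondence.{u} A B}
    (h : UnitarilyEquivalent (E.tensor R) (R.tensor F)) (n : ℕ) :
    UnitarilyEquivalent ((E.tensorPowSucc n).tensor R) (R.tensor (F.tensorPowSucc n)) := by
  induction n with
  | zero => exact h
  | succ n ih =>
    calc UnitarilyEquivalent (((E.tensorPowSucc n).tensor E).tensor R)
          ((E.tensorPowSucc n).tensor (E.tensor R)) := tensor_assoc _ _ _
      UnitarilyEquivalent _ ((E.tensorPowSucc n).tensor (R.tensor F)) := h.tensor_right _
      UnitarilyEquivalent _ (((E.tensorPowSucc n).tensor R).tensor F) := (tensor_assoc _ _ _).symm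
      UnitarilyEquivalent _ ((R.tensor (F.tensorPowSucc n)).tensor F) := ih.tensor_left _
      UnitarilyEquivalent _ (R.tensor ((F.tensorPowSucc n).tensor F)) := tensor_assoc _ _ _

/-- Intertwining correspondences compose. -/
theorem UnitarilyEquivalent.intertwine_tensor {E : Correspondence.{u} A A}
    {F : Correspondence.{u} B B} {G : Correspondence.{u} C C} {R : Correspondence.{u} A B}
    {R' : Correspondence.{u} B C} (h : UnitarilyEquivalent (E.tensor R) (R.tensor F))
    (h' : UnitarilyEquivalent (F.tensor R') (R'.tensor G)) :
    UnitarilyEquivalent (E.tensor (R.tensor R')) ((R.tensor R').tensor G) :=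
  calc UnitarilyEquivalent (E.tensor (R.tensor R')) ((E.tensor R).tensor R') :=
        (tensor_assoc _ _ _).symm
    UnitarilyEquivalent _ ((R.tensor F).tensor R') := h.tensor_left _
    UnitarilyEquivalent _ (R.tensor (F.tensor R')) := tensor_assoc _ _ _
    UnitarilyEquivalent _ (R.tensor (R'.tensor G)) := h'.tensor_right _
    UnitarilyEquivalent _ ((R.tensor R').tensor G) := (tensor_assoc _ _ _).symm

/-- If `E^{⊗ (m + 1)} ≈ R ⊗ S`, `F^{⊗ (n + 1)} ≈ R' ⊗ S'` and `R` intertwines `E` and `F`, then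
`E^{⊗ (m + n + 2)} ≈ (R ⊗ R') ⊗ (S' ⊗ S)`. -/
theorem UnitarilyEquivalent.tensorPowSucc_tensor {E : Correspondence.{u} A A}
    {F : Correspondence.{u} B B} {R : Correspondence.{u} A B} {S : Correspondence.{u} B A}
    {R' : Correspondence.{u} B C} {S' : Correspondence.{u} C B} {m n : ℕ}
    (h : UnitarilyEquivalent (E.tensorPowSucc m) (R.tensor S))
    (h' : UnitarilyEquivalent (F.tensorPowSucc n) (R'.tensor S'))
    (hR : UnitarilyEquivalent (E.tensor R) (R.tensor F)) :
    UnitarilyEquivalent (E.tensorPowSucc (n + m + 1))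
      ((R.tensor R').tensor (S'.tensor S)) :=
  calc UnitarilyEquivalent (E.tensorPowSucc (n + m + 1))
        ((E.tensorPowSucc n).tensor (E.tensorPowSucc m)) := tensorPowSucc_add _ _ _
    UnitarilyEquivalent _ ((E.tensorPowSucc n).tensor (R.tensor S)) := h.tensor_right _
    UnitarilyEquivalent _ (((E.tensorPowSucc n).tensor R).tensor S) := (tensor_assoc _ _ _).symm
    UnitarilyEquivalent _ ((R.tensor (F.tensorPowSucc n)).tensor S) :=
      (hR.tensorPowSucc_intertwine n).tensor_left _
    UnitarilyEquivalent _ ((R.tensor (R'.tensor S')).tensor S) :=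
      (h'.tensor_right R).tensor_left S
    UnitarilyEquivalent _ (((R.tensor R').tensor S').tensor S) :=
      (tensor_assoc _ _ _).symm.tensor_left S
    UnitarilyEquivalent _ ((R.tensor R').tensor (S'.tensor S)) := tensor_assoc _ _ _

end Powers

/-! ### From strong shift equivalence to shift equivalence -/

theorem ElementaryStrongShiftEquivalent.shiftEquivalent {E : Correspondence.{u} A A}
    {F : Correspondence.{u} B B} (h : E.ElementaryStrongShiftEquivalent F) :
    E.ShiftEquivalent F := by
  obtain ⟨R, S, hE, hF⟩ := h
  -- Index `0` is lag one. The intertwining relations are the two bracketings of `S ⊗ R ⊗ S` and of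
  -- `R ⊗ S ⊗ R`.
  refine ⟨R, S, 0, hE, hF, ?_, ?_⟩
  · exact (hE.tensor_right S).trans ((tensor_assoc _ _ _).symm.trans (hF.symm.tensor_left S))
  · exact (hE.tensor_left R).trans ((tensor_assoc _ _ _).trans (hF.symm.tensor_right R))

theorem ShiftEquivalent.trans {E : Correspondence.{u} A A} {F : Correspondence.{u} B B}
    {G : Correspondence.{u} C C} (h : E.ShiftEquivalent F) (h' : F.ShiftEquivalent G) :
    E.ShiftEquivalent G := by
  obtain ⟨R, S, m, hE, hF, hS, hR⟩ := h
  obtain ⟨R', S', n, hF', hG, hS', hR'⟩ := h'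
  -- The lags `m + 1` and `n + 1` add up. The inverse of `hS` says that `S` intertwines `F` and `E`,
  -- so the composition lemma also serves the backward direction.
  refine ⟨R.tensor R', S'.tensor S, n + m + 1, hE.tensorPowSucc_tensor hF' hR, ?_,
    (hS'.symm.intertwine_tensor hS.symm).symm, hR.intertwine_tensor hR'⟩
  rw [add_comm n m]
  exact hG.tensorPowSucc_tensor hF hS'.symm

theorem StrongShiftEquivalent.shiftEquivalent {E : Correspondence.{u} A A}
    {F : Correspondence.{u} B B} (h : E.StrongShiftEquivalent F) : E.ShiftEquivalent F := by
  -- The algebra changes along the chain, so the induction runs over bundled correspondences.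
  have key : ∀ S T : BundledCorrespondence.{u}, Relation.TransGen
      (fun S T : BundledCorrespondence.{u} => S.corr.ElementaryStrongShiftEquivalent T.corr) S T →
      S.corr.ShiftEquivalent T.corr := fun S T hST => by
    induction hST with
    | single h => exact h.shiftEquivalent
    | tail _ h ih => exact ih.trans h.shiftEquivalent
  exact key ⟨A, E⟩ ⟨B, F⟩ h

/-! ### Cancelling an identity correspondence on the right -/

section RightUnit

variable (X : Correspondence.{u} A B)

/-- Adjointable operators are automatically module maps: move `a` across the inner product and
compare. -/
theorem lsmul_rsmul (a : A) (b : B) (ξ : X.carrier) :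
    X.lsmul a (X.rsmul b ξ) = X.rsmul b (X.lsmul a ξ) := by
  refine X.eq_of_inner .id fun η => ?_
  rw [X.inner_lsmul_eq, X.inner_rsmul, X.inner_rsmul, X.inner_lsmul_eq]

/-- The map `b ↦ ξ · b`. -/
noncomputable def rsmulCLM (ξ : X.carrier) : B →L[ℂ] X.carrier :=
  (X.rsmul.flip ξ).mkContinuous ‖ξ‖ fun b => (X.norm_rsmul_le b ξ).trans_eq (mul_comm _ _)

/-- The right action of a correspondence is nondegenerate. -/
theorem mem_closure_range_rsmul (ξ : X.carrier) : ξ ∈ closure (Set.range fun b => X.rsmul b ξ) := by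
  let _ := CStarAlgebra.spectralOrder B
  have _ := CStarAlgebra.spectralOrderedRing B
  have hl := CStarAlgebra.increasingApproximateUnit B
  -- For `‖e‖ ≤ 1` this quantity dominates `‖ξ · e - ξ‖ ^ 2`, as expanding the inner product below
  -- shows.
  have h0 : Filter.Tendsto (fun e => 2 * ‖X.inner ξ ξ * e - X.inner ξ ξ‖)
      (CStarAlgebra.approximateUnit B) (nhds 0) := by
    simpa using ((hl.tendsto_mul_left (X.inner ξ ξ)).sub_const (X.inner ξ ξ)).norm.const_mul 2
  have h1 : Filter.Tendsto (fun e => ‖X.rsmul e ξ - ξ‖ ^ 2)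
      (CStarAlgebra.approximateUnit B) (nhds 0) := by
    refine squeeze_zero' (.of_forall fun _ => by positivity) ?_ h0
    filter_upwards [hl.eventually_norm] with e he
    have h2 : X.inner (X.rsmul e ξ - ξ) (X.rsmul e ξ - ξ)
        = star e * (X.inner ξ ξ * e - X.inner ξ ξ) - (X.inner ξ ξ * e - X.inner ξ ξ) := by
      simp only [map_sub, LinearMap.sub_apply, X.inner_rsmul, X.inner_rsmul_left, mul_sub, mul_assoc]
      abel
    rw [X.norm_sq, h2, two_mul]
    refine (norm_sub_le _ _).trans (add_le_add_left ((norm_mul_le _ _).trans ?_) _)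
    rw [norm_star]
    exact mul_le_of_le_one_left (norm_nonneg _) he
  have h3 : Filter.Tendsto (fun e => X.rsmul e ξ) (CStarAlgebra.approximateUnit B) (nhds ξ) := by
    rw [tendsto_iff_norm_sub_tendsto_zero]
    simpa [Real.sqrt_sq] using h1.sqrt
  exact mem_closure_of_tendsto h3 (.of_forall fun e => ⟨e, rfl⟩)

theorem denseSpan_rsmul {ι : Type*} {b : ι → B} (hb : DenseSpan b) :
    DenseSpan fun p : X.carrier × ι => X.rsmul (b p.2) p.1 := by
  refine DenseSpan.of_forall_mem .id fun ξ => ?_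
  refine closure_minimal ?_ (Submodule.isClosed_topologicalClosure _)
    (X.mem_closure_range_rsmul ξ)
  rintro _ ⟨c, rfl⟩
  exact hb.map_mem (X.rsmulCLM ξ) (Submodule.isClosed_topologicalClosure _)
    (fun i => DenseSpan.mem_topologicalClosure
      (fun p : X.carrier × ι => X.rsmul (b p.2) p.1) (ξ, i)) c

/-- If `N` has the same matrix coefficients as the identity correspondence of `B`, then
`X ⊗_B N ≈ X`. -/
theorem tensor_right_unit {N : Correspondence.{u} B B} {ι : Type*} {x : ι → N.carrier} {b : ι → B}
    (hx : DenseSpan x) (hb : DenseSpan b)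
    (h : ∀ c i j, N.inner (x i) (N.lsmul c (x j)) = star (b i) * c * b j) :
    UnitarilyEquivalent (X.tensor N) X := by
  refine unitarilyEquivalent_of_denseSpan
    (denseSpan_tmul (X := X) (x := fun ξ : X.carrier => ξ) .id hx) (X.denseSpan_rsmul hb)
    (fun p q => ?_) (fun a p q => ?_)
  -- The unitary sends `ξ ⊗ x i` to `ξ · b i`; both Gram entries are `star (b i) * ⟪ξ, ξ'⟫ * b j`.
  · rw [inner_tmul, h, X.inner_rsmul, X.inner_rsmul_left]
  · rw [lsmul_tmul, inner_tmul, h, X.lsmul_rsmul, X.inner_rsmul, X.inner_rsmul_left]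

end RightUnit

end Correspondence

/-! ### The conjugate space and the dual bimodule -/

/-- The complex conjugate of a complex vector space. -/
def ConjSpace (V : Type u) : Type u := V

namespace ConjSpace

variable {V : Type u} [AddCommGroup V] [Module ℂ V]

instance : AddCommGroup (ConjSpace V) := inferInstanceAs (AddCommGroup V)

instance : Module ℂ (ConjSpace V) := Module.compHom V (starRingEnd ℂ)

/-- The conjugate-linear identity map onto the conjugate space. -/
def toConj (V : Type u) [AddCommGroup V] [Module ℂ V] : V ≃ₗ⋆[ℂ] ConjSpace V where
  toFun v := v
  invFun v := v
  left_inv _ := rfl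
  right_inv _ := rfl
  map_add' _ _ := rfl
  map_smul' c v := by
    change c • v = conj (conj c) • v
    rw [Complex.conj_conj]

@[simp]
theorem toConj_smul (c : ℂ) (v : V) : toConj V (c • v) = starRingEnd ℂ c • toConj V v :=
  (toConj V).map_smulₛₗ c v

@[simp]
theorem toConj_symm_smul (c : ℂ) (v : ConjSpace V) :
    (toConj V).symm (c • v) = starRingEnd ℂ c • (toConj V).symm v :=
  rfl

end ConjSpace

namespace Correspondence

variable {A B C D : Type u} [NonUnitalCStarAlgebra A] [NonUnitalCStarAlgebra B]
  [NonUnitalCStarAlgebra C] [NonUnitalCStarAlgebra D]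

open ConjSpace

/-- A full left `A`-valued inner product that is compatible with the right inner product. -/
structure LeftInner (M : Correspondence.{u} A B) where
  linner : M.carrier →ₗ[ℂ] M.carrier →ₗ⋆[ℂ] A
  linner_lsmul : ∀ a ξ η, linner (M.lsmul a ξ) η = a * linner ξ η
  star_linner : ∀ ξ η, star (linner ξ η) = linner η ξ
  linner_self_pos : ∀ ξ, IsPos (linner ξ ξ)
  linner_compat : ∀ ξ η ζ, M.lsmul (linner ξ η) ζ = M.rsmul (M.inner η ζ) ξ
  denseSpan_linner : DenseSpan fun p : M.carrier × M.carrier => linner p.1 p.2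

namespace LeftInner

variable {M : Correspondence.{u} A B}

/-- The left action of an imprimitivity bimodule is injective. -/
theorem eq_zero_of_lsmul (K : LeftInner M) {a : A} (h : ∀ ξ, M.lsmul a ξ = 0) : a = 0 := by
  -- Left multiplication by `a` kills every left inner product, hence all of `A` by fullness;
  -- evaluating at `star a` gives `a * star a = 0`.
  have h1 := K.denseSpan_linner.clm_eq (L := ContinuousLinearMap.mul ℂ A a) (L' := 0)
    (fun p => by simp [← K.linner_lsmul, h]) (star a)
  exact (CStarRing.mul_star_self_eq_zero_iff a).1 (by simpa using h1)

variable (K : LeftInner M)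

theorem linner_lsmul_right (a : A) (ξ η : M.carrier) :
    K.linner ξ (M.lsmul a η) = K.linner ξ η * star a := by
  rw [← K.star_linner, K.linner_lsmul, star_mul, K.star_linner]

/-- The left action is faithful, so it suffices to let both sides act on `ζ`; by compatibility each
gives `ξ · (b ⟪η, ζ⟫)`. This makes the left action on the dual a `*`-action. -/
theorem linner_rsmul (b : B) (ξ η : M.carrier) :
    K.linner (M.rsmul b ξ) η = K.linner ξ (M.rsmul (star b) η) := by
  refine sub_eq_zero.1 (K.eq_zero_of_lsmul fun ζ => ?_)
  rw [map_sub, LinearMap.sub_apply, K.linner_compat, K.linner_compat, M.inner_rsmul_left,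
    star_star, M.rsmul_mul, sub_self]

/-- The dual of an imprimitivity bimodule, before completion. -/
noncomputable def preDual : PreCorrespondence.{u} B A where
  carrier := ConjSpace M.carrier
  rsmul := LinearMap.mk₂ ℂ
    (fun a ξ => toConj M.carrier (M.lsmul (star a) ((toConj M.carrier).symm ξ)))
    (by intros; simp) (by intros; simp) (by intros; simp) (by intros; simp)
  rsmul_mul a a' ξ := by simp [M.lsmul_mul]
  inner := LinearMap.mk₂'ₛₗ (starRingEnd ℂ) (RingHom.id ℂ)
    (fun ξ η => K.linner ((toConj M.carrier).symm ξ) ((toConj M.carrier).symm η))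
    (by intros; simp) (by intros; simp) (by intros; simp) (by intros; simp)
  inner_rsmul ξ η a := by simp [K.linner_lsmul_right]
  star_inner ξ η := K.star_linner _ _
  inner_self_pos ξ := K.linner_self_pos _
  lsmul := LinearMap.mk₂ ℂ
    (fun b ξ => toConj M.carrier (M.rsmul (star b) ((toConj M.carrier).symm ξ)))
    (by intros; simp) (by intros; simp) (by intros; simp) (by intros; simp)
  lsmul_mul b b' ξ := by simp [M.rsmul_mul]
  inner_lsmul b ξ η := by simp [K.linner_rsmul]

/-- The dual `B`-`A`-bimodule of an imprimitivity bimodule. -/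
noncomputable def dual : Correspondence.{u} B A := K.preDual.completion

/-- The vector of the dual bimodule given by a vector of the bimodule. -/
noncomputable def toDual (ξ : M.carrier) : K.dual.carrier := K.preDual.toCompl (toConj M.carrier ξ)

theorem inner_toDual (ξ η : M.carrier) : K.dual.inner (K.toDual ξ) (K.toDual η) = K.linner ξ η :=
  K.preDual.innerL_toCompl _ _

theorem lsmul_toDual (b : B) (ξ : M.carrier) :
    K.dual.lsmul b (K.toDual ξ) = K.toDual (M.rsmul (star b) ξ) :=
  K.preDual.extendAct_toCompl K.preDual.norm_lsmul_le b _

theorem denseSpan_toDual : DenseSpan K.toDual := by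
  have h : Dense (Set.range K.toDual) := K.preDual.denseRange_toCompl.mono <| by
    rintro _ ⟨ξ, rfl⟩
    exact ⟨(toConj M.carrier).symm ξ, rfl⟩
  exact h.mono Submodule.subset_span

/-- `X ⊗_A (M ⊗_B M*) ≈ X` -/
theorem tensor_dual (X : Correspondence.{u} C A) :
    UnitarilyEquivalent (X.tensor (M.tensor K.dual)) X := by
  refine X.tensor_right_unit (N := M.tensor K.dual)
    (denseSpan_tmul (x := fun ξ : M.carrier => ξ) .id K.denseSpan_toDual) K.denseSpan_linner
    fun c p q => ?_
  -- Compatibility turns the right action of `⟪c ξ', ξ⟫` on `η'` into a left action on `ξ`, which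
  -- then leaves the left inner product as a factor.
  rw [lsmul_tmul, inner_tmul, lsmul_toDual, inner_toDual, M.star_inner, ← K.linner_compat,
    K.linner_lsmul_right, K.star_linner, K.linner_lsmul, K.star_linner, mul_assoc]

/-- `X ⊗_B (M* ⊗_A M) ≈ X` -/
theorem tensor_dual_tensor
    (h : DenseSpan fun p : M.carrier × M.carrier => M.inner p.1 p.2) (X : Correspondence.{u} C B) :
    UnitarilyEquivalent (X.tensor (K.dual.tensor M)) X := by
  refine X.tensor_right_unit (N := K.dual.tensor M)
    (denseSpan_tmul (y := fun ξ : M.carrier => ξ) K.denseSpan_toDual .id) h fun c p q => ?_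
  rw [lsmul_tmul, inner_tmul, lsmul_toDual, inner_toDual, K.linner_compat, M.inner_rsmul,
    M.inner_rsmul_left, star_star, M.star_inner, mul_assoc]

end LeftInner

theorem StrongMoritaEquivalent.elementaryStrongShiftEquivalent {E : Correspondence.{u} A A}
    {F : Correspondence.{u} B B} (h : E.StrongMoritaEquivalent F) :
    E.ElementaryStrongShiftEquivalent F := by
  -- Definiteness and completeness of the left inner product are dropped: the dual is separated and
  -- completed anyway.
  obtain ⟨M, ⟨linner, h1, h2, h3, -, -, h4, h5, h6⟩, h⟩ := h
  let K : LeftInner M := ⟨linner, h1, h2, h3, h4, h5⟩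
  -- The choice `M* ⊗ E` for the second factor would put `M ⊗ M*` to the left of `E`, where a
  -- degenerate left action prevents cancellation.
  refine ⟨M, F.tensor K.dual, .symm ?_, .symm ?_⟩
  · calc UnitarilyEquivalent (M.tensor (F.tensor K.dual)) ((M.tensor F).tensor K.dual) :=
          (tensor_assoc _ _ _).symm
      UnitarilyEquivalent _ ((E.tensor M).tensor K.dual) := h.symm.tensor_left _
      UnitarilyEquivalent _ (E.tensor (M.tensor K.dual)) := tensor_assoc _ _ _
      UnitarilyEquivalent _ E := K.tensor_dual E
  · exact (tensor_assoc _ _ _).trans (K.tensor_dual_tensor h6 F)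

end Correspondence

end CStarCorr

theorem theoremT {A B : Type u} [NonUnitalCStarAlgebra A] [NonUnitalCStarAlgebra B]
    (E : CStarCorr.Correspondence A A) (F : CStarCorr.Correspondence B B) :
    (E.StrongMoritaEquivalent F → E.ElementaryStrongShiftEquivalent F) ∧
    (E.ElementaryStrongShiftEquivalent F → E.StrongShiftEquivalent F) ∧
    (E.StrongShiftEquivalent F → E.ShiftEquivalent F) :=
  ⟨CStarCorr.Correspondence.StrongMoritaEquivalent.elementaryStrongShiftEquivalent,
    fun h => Relation.TransGen.single h,
    CStarCorr.Correspondence.StrongShiftEquivalent.shiftEquivalent⟩
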